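/- Let $(M,g)$ be a smooth finite-dimensional pseudo-Riemannian manifold, where $g$ is a smooth nondegenerate symmetric $(0,2)$-tensor field of any signature. Let $\mathrm{Rm}$ be its Riemann tensor and $\nabla^i\mathrm{Rm}$ ($i\ge 0$) the covariant derivatives of $\mathrm{Rm}$ for the Levi-Civita connection. Call a covariant tensor field on $M$ a *curvature tensor field* if it belongs to the smallest family of covariant tensor fields (of all ranks $r\ge 0$) that contains all $\nabla^i\mathrm{Rm}$ and is closed under linear combinations with constant real coefficients, tensor products, tensor products with $g$, permutations of the indices, and metric contractions $T_{\mu\nu\cdots}\mapsto g^{\mu\nu}T_{\mu\nu\cdots}$. (So every term contains at least one factor $\nabla^i\mathrm{Rm}$.) A *polynomial curvature invariant* of $(M,g)$ is a curvature tensor field of rank $0$, and $(M,g)$ is *VSI* if all its polynomial curvature invariants vanish at every point of $M$. A *curvature operator* at $p\in M$ is a linear operator $$\mathsf T:(T_pM)^{\otimes k}\to(T_pM)^{\otimes k},\qquad x^{\nu_1\dots\nu_k}\mapsto T_{\nu_1\dots\nu_k}{}^{\mu_1\dots\mu_k}\,x^{\nu_1\dots\nu_k},\qquad k\ge 1,$$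 obtained by raising $k$ indices of a curvature tensor field $T$ of rank $2k$ at $p$. **Theorem.** $(M,g)$ is VSI if and only if, for every $p\in M$ and every $k\ge1$, every curvature operator on $(T_pM)^{\otimes k}$ is nilpotent. -/

import Mathlib

set_option maxSynthPendingDepth 3

open scoped Manifold ContDiff TensorProduct

noncomputable section

/-! ### Tensor algebra on a vector space with a nondegenerate bilinear form -/

namespace CovTensor

variable {V : Type*} [AddCommGroup V] [Module ℝ V]

/-- The tensor product `(S ⊗ T)(v, w) = S v * T w` of covariant tensors of ranks `r` and `s`. -/
def mul {r s : ℕ} (S : MultilinearMap ℝ (fun _ : Fin r => V) ℝ)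
    (T : MultilinearMap ℝ (fun _ : Fin s => V) ℝ) :
    MultilinearMap ℝ (fun _ : Fin (r + s) => V) ℝ :=
  ((LinearMap.mul' ℝ ℝ).compMultilinearMap (S.domCoprod T)).domDomCongr finSumFinEquiv

theorem mul_apply {r s : ℕ} (S : MultilinearMap ℝ (fun _ : Fin r => V) ℝ)
    (T : MultilinearMap ℝ (fun _ : Fin s => V) ℝ) (v : Fin (r + s) → V) :
    mul S T v = S (fun i => v (Fin.castAdd s i)) * T (fun i => v (Fin.natAdd r i)) := by
  simp [mul]

/-- A bilinear form, seen as a covariant tensor of rank two. -/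
def ofBilin (B : LinearMap.BilinForm ℝ V) : MultilinearMap ℝ (fun _ : Fin 2 => V) ℝ :=
  LinearMap.uncurryLeft
    ((MultilinearMap.ofSubsingletonₗ ℝ ℝ V ℝ (0 : Fin 1)).toLinearMap ∘ₗ B)

theorem ofBilin_apply (B : LinearMap.BilinForm ℝ V) (v : Fin 2 → V) :
    ofBilin B v = B (v 0) (v 1) := by
  simp [ofBilin, Fin.tail]

variable [FiniteDimensional ℝ V] (B : LinearMap.BilinForm ℝ V) (hB : B.Nondegenerate)

/-- The metric contraction of the first two slots, `∑ᵢ T(eᵢ, eⁱ, …)`, that is `g^{μν} T_{μν…}`: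
here `(eᵢ)` is a basis and `(eⁱ)` its `B`-dual basis (the sum does not depend on the basis). -/
def contract {r : ℕ} (T : MultilinearMap ℝ (fun _ : Fin (r + 2) => V) ℝ) :
    MultilinearMap ℝ (fun _ : Fin r => V) ℝ :=
  ∑ i, (T.curryLeft (Module.finBasis ℝ V i)).curryLeft (B.dualBasis hB (Module.finBasis ℝ V) i)

/-- Raising all indices of a covariant tensor of rank `k`:
`S ↦ ∑ S(e_{i₁}, …, e_{iₖ}) e^{i₁} ⊗ ⋯ ⊗ e^{iₖ}`, with `(eᵢ)` a basis and `(eⁱ)` its `B`-dual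
basis (the sum does not depend on the basis). -/
def raise (k : ℕ) :
    MultilinearMap ℝ (fun _ : Fin k => V) ℝ →ₗ[ℝ] (⨂[ℝ] _ : Fin k, V) where
  toFun S := ∑ i : Fin k → Fin (Module.finrank ℝ V),
    S (fun j => Module.finBasis ℝ V (i j)) •
      PiTensorProduct.tprod ℝ (fun j => B.dualBasis hB (Module.finBasis ℝ V) (i j))
  map_add' S T := by simp [add_smul, Finset.sum_add_distrib]
  map_smul' c S := by simp [mul_smul, Finset.smul_sum]

/-- The linear operator on `V ⊗ ⋯ ⊗ V` (`k` factors) obtained from a covariant tensor `T` of rank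
`2k` by raising its last `k` indices:
`x^{ν₁…νₖ} ↦ T_{ν₁…νₖ}^{μ₁…μₖ} x^{ν₁…νₖ}`. -/
def toOperator {k : ℕ} (T : MultilinearMap ℝ (fun _ : Fin (k + k) => V) ℝ) :
    Module.End ℝ (⨂[ℝ] _ : Fin k, V) :=
  PiTensorProduct.lift
    ((raise B hB k).compMultilinearMap (T.domDomCongr finSumFinEquiv.symm).currySum)

theorem toOperator_tprod {k : ℕ} (T : MultilinearMap ℝ (fun _ : Fin (k + k) => V) ℝ)
    (v : Fin k → V) :
    toOperator B hB T (PiTensorProduct.tprod ℝ v) =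
      ∑ i : Fin k → Fin (Module.finrank ℝ V),
        T (Fin.append v (fun j => Module.finBasis ℝ V (i j))) •
          PiTensorProduct.tprod ℝ (fun j => B.dualBasis hB (Module.finBasis ℝ V) (i j)) := by
  simp only [toOperator, PiTensorProduct.lift.tprod, LinearMap.compMultilinearMap_apply, raise,
    LinearMap.coe_mk, AddHom.coe_mk]
  refine Finset.sum_congr rfl fun i _ => ?_
  congr 1
  change T _ = T _
  congr 1
  ext j
  obtain ⟨j, rfl⟩ := finSumFinEquiv.surjective j
  cases j <;> simp [-Fin.natAdd_eq_addNat]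

end CovTensor

/-! ### Local formulas in a chart

A metric in a chart is a function `G : E → E →L[ℝ] E →L[ℝ] ℝ`, of which only the germ at the point
under consideration matters. -/

namespace LocalMetric

variable {E : Type*} [NormedAddCommGroup E] [NormedSpace ℝ E]

/-- Christoffel symbols of the first kind,
`Γ(u, v, w) = (D_u G(v, w) + D_v G(u, w) - D_w G(u, v)) / 2`. -/
def christoffelFirst (G : E → E →L[ℝ] E →L[ℝ] ℝ) (x : E) : E →L[ℝ] E →L[ℝ] E →L[ℝ] ℝ :=
  let D : E →L[ℝ] E →L[ℝ] E →L[ℝ] ℝ := fderiv ℝ G x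
  let D' : E →L[ℝ] E →L[ℝ] E →L[ℝ] ℝ :=
    (ContinuousLinearMap.flipₗᵢ ℝ E E ℝ).toContinuousLinearEquiv.toContinuousLinearMap ∘L D.flip
  (1 / 2 : ℝ) • (D + D.flip - D')

theorem christoffelFirst_apply (G : E → E →L[ℝ] E →L[ℝ] ℝ) (x u v w : E) :
    christoffelFirst G x u v w =
      (1 / 2) * (fderiv ℝ G x u v w + fderiv ℝ G x v u w - fderiv ℝ G x w u v) := by
  simp [christoffelFirst]

/-- Christoffel symbols `Γ(u, v)` of the Levi-Civita connection, `∇_u v = D_u v + Γ(u, v)`: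
the index of `christoffelFirst` is raised with the inverse of the metric `G x : E → E*`. -/
def christoffel (G : E → E →L[ℝ] E →L[ℝ] ℝ) (x : E) : E →L[ℝ] E →L[ℝ] E :=
  ContinuousLinearMap.compL ℝ E (E →L[ℝ] ℝ) E (G x).inverse ∘L christoffelFirst G x

/-- The covariant derivative of a covariant tensor of rank `r` in a chart,
`(∇T)(v₀, …, vᵣ) = (D_{v₀} T)(v₁, …, vᵣ) - ∑ⱼ T(v₁, …, Γ(v₀, vⱼ), …, vᵣ)`. -/
def covDeriv (G : E → E →L[ℝ] E →L[ℝ] ℝ) {r : ℕ}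
    (T : E → ContinuousMultilinearMap ℝ (fun _ : Fin r => E) ℝ) (x : E) :
    ContinuousMultilinearMap ℝ (fun _ : Fin (r + 1) => E) ℝ :=
  ContinuousLinearMap.uncurryLeft
    (fderiv ℝ T x -
      ∑ j, (ContinuousLinearMap.apply ℝ (ContinuousMultilinearMap ℝ (fun _ : Fin r => E) ℝ) (T x) ∘L
        (ContinuousMultilinearMap.compContinuousLinearMapContinuousMultilinear ℝ
          (fun _ : Fin r => E) (fun _ : Fin r => E) ℝ).toContinuousLinearMap
            (fun _ => ContinuousLinearMap.id ℝ E) j) ∘L christoffel G x)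

theorem covDeriv_apply (G : E → E →L[ℝ] E →L[ℝ] ℝ) {r : ℕ}
    (T : E → ContinuousMultilinearMap ℝ (fun _ : Fin r => E) ℝ) (x : E) (v : Fin (r + 1) → E) :
    covDeriv G T x v = fderiv ℝ T x (v 0) (Fin.tail v) -
      ∑ j : Fin r, T x (Function.update (Fin.tail v) j (christoffel G x (v 0) (v j.succ))) := by
  simp only [covDeriv, ContinuousLinearMap.uncurryLeft_apply, sub_apply, sum_apply]
  congr 1
  refine Finset.sum_congr rfl fun j _ => ?_
  change T x _ = T x _
  congr 1
  ext i
  by_cases h : i = j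
  · subst h; simp [Fin.tail]
  · simp [h]

/-- The curvature endomorphism
`R(u, v) w = (D_u Γ)(v, w) - (D_v Γ)(u, w) + Γ(u, Γ(v, w)) - Γ(v, Γ(u, w))`. -/
def riemannEnd (G : E → E →L[ℝ] E →L[ℝ] ℝ) (x : E) (u v w : E) : E :=
  fderiv ℝ (christoffel G) x u v w - fderiv ℝ (christoffel G) x v u w
    + christoffel G x u (christoffel G x v w) - christoffel G x v (christoffel G x u w)

variable [FiniteDimensional ℝ E]

/-- The covariant Riemann tensor `Rm(u, v, w, z) = G(R(u, v) w, z)` in a chart. -/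
def riemann (G : E → E →L[ℝ] E →L[ℝ] ℝ) (x : E) :
    ContinuousMultilinearMap ℝ (fun _ : Fin 4 => E) ℝ where
  toFun v := G x (riemannEnd G x (v 0) (v 1) (v 2)) (v 3)
  map_update_add' := by
    intro inst v i a b
    obtain rfl : inst = fun a b => instDecidableEqFin 4 a b := Subsingleton.elim _ _
    fin_cases i <;> simp [riemannEnd] <;> ring
  map_update_smul' := by
    intro inst v i c a
    obtain rfl : inst = fun a b => instDecidableEqFin 4 a b := Subsingleton.elim _ _
    fin_cases i <;> simp [riemannEnd] <;> ring
  cont := by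
    simp only [riemannEnd]
    fun_prop

/-- The `i`-th covariant derivative `∇ⁱ Rm` of the Riemann tensor in a chart. -/
def iteratedRiemann (G : E → E →L[ℝ] E →L[ℝ] ℝ) :
    (i : ℕ) → E → ContinuousMultilinearMap ℝ (fun _ : Fin (4 + i) => E) ℝ
  | 0 => riemann G
  | i + 1 => covDeriv G (iteratedRiemann G i)

end LocalMetric

/-! ### Pseudo-Riemannian manifolds -/

/-- A (smooth) pseudo-Riemannian metric, of any signature, on a manifold `M` modelled on `E`. -/
structure PseudoRiemannianMetric (E : Type*) [NormedAddCommGroup E] [NormedSpace ℝ E]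
    (M : Type*) [TopologicalSpace M] [ChartedSpace E M] [IsManifold 𝓘(ℝ, E) ∞ M] where
  val (p : M) : TangentSpace 𝓘(ℝ, E) p →L[ℝ] TangentSpace 𝓘(ℝ, E) p →L[ℝ] ℝ
  symm (p : M) (v w : TangentSpace 𝓘(ℝ, E) p) : val p v w = val p w v
  nondegenerate (p : M) (v : TangentSpace 𝓘(ℝ, E) p) (hv : ∀ w, val p v w = 0) : v = 0
  contMDiff : ContMDiff 𝓘(ℝ, E) (𝓘(ℝ, E).prod 𝓘(ℝ, E →L[ℝ] E →L[ℝ] ℝ)) ∞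
    (fun p => Bundle.TotalSpace.mk' (E →L[ℝ] E →L[ℝ] ℝ)
      (E := fun p : M => TangentSpace 𝓘(ℝ, E) p →L[ℝ] TangentSpace 𝓘(ℝ, E) p →L[ℝ] ℝ) p (val p))

/-- Covariant tensor fields of rank `r` on `M`. -/
abbrev CovTensorField (E : Type*) [NormedAddCommGroup E] [NormedSpace ℝ E]
    (M : Type*) [TopologicalSpace M] [ChartedSpace E M] (r : ℕ) : Type _ :=
  ∀ p : M, MultilinearMap ℝ (fun _ : Fin r => TangentSpace 𝓘(ℝ, E) p) ℝ

namespace PseudoRiemannianMetric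

variable {E : Type*} [NormedAddCommGroup E] [NormedSpace ℝ E]
  {M : Type*} [TopologicalSpace M] [ChartedSpace E M] [IsManifold 𝓘(ℝ, E) ∞ M]
  (g : PseudoRiemannianMetric E M)

/-- The metric at a point as a bilinear form. -/
def bilin (p : M) : LinearMap.BilinForm ℝ (TangentSpace 𝓘(ℝ, E) p) :=
  LinearMap.mk₂ ℝ (fun v w => g.val p v w) (by simp) (by simp) (by simp) (by simp)

theorem bilin_nondegenerate (p : M) : (g.bilin p).Nondegenerate :=
  ⟨fun v hv => g.nondegenerate p v hv,
    fun v hv => g.nondegenerate p v fun w => (g.symm p v w).trans (hv w)⟩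

/-- The metric in the preferred chart at `p`: its pullback under the inverse of the chart. -/
def inChart (p : M) (x : E) : E →L[ℝ] E →L[ℝ] ℝ :=
  ContinuousLinearMap.bilinearComp (E := E) (F := E) (E' := E) (F' := E)
    (g.val ((extChartAt 𝓘(ℝ, E) p).symm x))
    (mfderiv 𝓘(ℝ, E) 𝓘(ℝ, E) (extChartAt 𝓘(ℝ, E) p).symm x)
    (mfderiv 𝓘(ℝ, E) 𝓘(ℝ, E) (extChartAt 𝓘(ℝ, E) p).symm x)

variable [FiniteDimensional ℝ E]

instance instFiniteDimensionalTangent (p : M) :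
    FiniteDimensional ℝ (TangentSpace 𝓘(ℝ, E) p) :=
  inferInstanceAs (FiniteDimensional ℝ E)

/-- The `i`-th covariant derivative `∇ⁱ Rm` of the Riemann tensor, a covariant tensor field of rank
`4 + i`: at `p` it is computed in the preferred chart at `p` and pulled back by the derivative of
this chart at `p`. -/
def curvature (i : ℕ) : CovTensorField E M (4 + i) := fun p =>
  (LocalMetric.iteratedRiemann (g.inChart p) i
    (extChartAt 𝓘(ℝ, E) p p)).toMultilinearMap.compLinearMap
      (fun _ => (mfderiv 𝓘(ℝ, E) 𝓘(ℝ, E) (extChartAt 𝓘(ℝ, E) p) p).toLinearMap)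

/-- The tensor fields built from the curvature: the smallest family of tensor fields that contains
the Riemann tensor and its covariant derivatives of all orders and is closed under linear
combinations with constant coefficients, tensor products, tensor products with the metric,
permutations of the indices and metric contractions. Every term of such a tensor contains at least
one factor `∇ⁱ Rm`; in particular the metric itself and constants are not built in this way.
As all indices can be lowered with the metric, covariant tensors suffice. -/
inductive IsCurvatureTensor : (r : ℕ) → CovTensorField E M r → Prop
  | curvature (i : ℕ) : IsCurvatureTensor (4 + i) (g.curvature i)
  | add {r : ℕ} {S T : CovTensorField E M r} :
      IsCurvatureTensor r S → IsCurvatureTensor r T → IsCurvatureTensor r (fun p => S p + T p)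
  | smul {r : ℕ} (c : ℝ) {T : CovTensorField E M r} :
      IsCurvatureTensor r T → IsCurvatureTensor r (fun p => c • T p)
  | mul {r s : ℕ} {S : CovTensorField E M r} {T : CovTensorField E M s} :
      IsCurvatureTensor r S → IsCurvatureTensor s T →
        IsCurvatureTensor (r + s) (fun p => CovTensor.mul (S p) (T p))
  | mulMetric {r : ℕ} {T : CovTensorField E M r} :
      IsCurvatureTensor r T →
        IsCurvatureTensor (r + 2) (fun p => CovTensor.mul (T p) (CovTensor.ofBilin (g.bilin p)))
  | permute {r s : ℕ} (e : Fin r ≃ Fin s) {T : CovTensorField E M r} :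
      IsCurvatureTensor r T → IsCurvatureTensor s (fun p => (T p).domDomCongr e)
  | contract {r : ℕ} {T : CovTensorField E M (r + 2)} :
      IsCurvatureTensor (r + 2) T →
        IsCurvatureTensor r
          (fun p => CovTensor.contract (g.bilin p) (g.bilin_nondegenerate p) (T p))

/-- Polynomial curvature invariants: the scalar functions built from the Riemann tensor and its
covariant derivatives, i.e. the linear combinations of complete contractions of products of
the metric and of at least one `∇ⁱ Rm`. -/
def IsPolynomialInvariant (f : M → ℝ) : Prop :=
  ∃ T : CovTensorField E M 0, g.IsCurvatureTensor 0 T ∧ f = fun p => T p ![]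

/-- `(M, g)` is VSI: all its polynomial curvature invariants vanish identically. -/
def IsVSI : Prop :=
  ∀ f : M → ℝ, g.IsPolynomialInvariant f → ∀ p, f p = 0

/-- The curvature operators at `p` on `k`-fold contravariant tensors: the linear operators on
`T_pM ⊗ ⋯ ⊗ T_pM` (`k` factors) obtained by raising `k` indices of a tensor field of rank `2k`
that is built from the curvature. -/
def IsCurvatureOperator (p : M) (k : ℕ)
    (A : Module.End ℝ (⨂[ℝ] _ : Fin k, TangentSpace 𝓘(ℝ, E) p)) : Prop :=
  ∃ T : CovTensorField E M (k + k), g.IsCurvatureTensor (k + k) T ∧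
    A = CovTensor.toOperator (g.bilin p) (g.bilin_nondegenerate p) (T p)

end PseudoRiemannianMetric

end

open scoped Manifold ContDiff TensorProduct

/-! ### Nilpotency from the traces of the powers -/

namespace LinearMap

open Polynomial

variable {K W : Type*} [Field K] [AddCommGroup W] [Module K W]

/-! Curvature operators are closed under composition, since composing means contracting a tensor
product (`exists_composition`), and the trace of one is a complete contraction, hence a polynomial
invariant (`isPolynomialInvariant_trace`). On a VSI manifold every positive power of a curvature
operator is therefore traceless, and in characteristic zero this forces nilpotency
(`isNilpotent_of_trace_pow_eq_zero`).

Conversely, if `f` is a polynomial invariant, then `f g` is a curvature tensor of rank 2 whose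
operator is `f` times the identity (`toOperator_eq_smul_one`). Nilpotency of this operator gives `f
= 0` in positive dimension; in dimension zero all curvature tensors vanish anyway.

To keep index bookkeeping light, slots are labelled by sum types (`IsCurvatureFunction`), so that
free and contracted indices can be separated by a bijection. -/

theorem trace_aeval_mul_X_eq_zero {A : Module.End K W}
    (h : ∀ n : ℕ, trace K W (A ^ (n + 1)) = 0) (Q : K[X]) :
    trace K W (aeval A (Q * X)) = 0 := by
  induction Q using Polynomial.induction_on' with
  | add p q hp hq => rw [add_mul, map_add, map_add, hp, hq, add_zero]
  | monomial n a =>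
    rw [monomial_mul_X, aeval_monomial, ← Algebra.smul_def, map_smul, h, smul_zero]

/-- The trace of a projection is its rank, and characteristic zero lets the rank be read off as a
natural number. -/
theorem eq_zero_of_isIdempotentElem_of_trace_eq_zero [CharZero K] [FiniteDimensional K W]
    {P : Module.End K W} (hP : IsIdempotentElem P) (h : trace K W P = 0) : P = 0 := by
  have hproj : IsProj (range P) P := by
    refine ⟨fun x => mem_range_self P x, ?_⟩
    rintro _ ⟨y, rfl⟩
    exact LinearMap.congr_fun hP.eq y
  rw [hproj.trace, Nat.cast_eq_zero, Submodule.finrank_eq_zero] at h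
  exact range_eq_bot.mp h

/-- No eigenvalues are needed: the Fitting projection onto the part where `A` is invertible is a
polynomial in `A` without constant term. It is thus traceless, hence zero. -/
theorem isNilpotent_of_trace_pow_eq_zero [CharZero K] [FiniteDimensional K W]
    {A : Module.End K W} (h : ∀ n : ℕ, trace K W (A ^ (n + 1)) = 0) : IsNilpotent A := by
  obtain ⟨m, q, hq, hndvd⟩ : ∃ (m : ℕ) (q : K[X]), A.charpoly = X ^ m * q ∧ ¬X ∣ q := by
    obtain ⟨q, hq⟩ := exists_eq_pow_rootMultiplicity_mul_and_not_dvd A.charpoly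
      A.charpoly_monic.ne_zero 0
    exact ⟨_, q, by simpa only [C_0, sub_zero] using hq⟩
  -- The exponent `m + 1` guarantees a factor `X` even when `m = 0`, so the trace of the projection
  -- involves positive powers of `A` only.
  obtain ⟨u, v, huv⟩ : IsCoprime (X ^ (m + 1)) q :=
    IsCoprime.pow_left ((irreducible_X.coprime_iff_not_dvd).mpr hndvd)
  have hA : aeval A (X ^ m * q) = 0 := by rw [← hq, A.aeval_self_charpoly]
  have hv : v * q = 1 - u * X ^ (m + 1) := by rw [← huv]; ring
  have hidem : IsIdempotentElem (aeval A (u * X ^ (m + 1))) := by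
    have : aeval A (u * X ^ (m + 1) * (1 - u * X ^ (m + 1))) = 0 := by
      rw [← hv, show u * X ^ (m + 1) * (v * q) = u * X * v * (X ^ m * q) by ring, map_mul, hA,
        mul_zero]
    rw [mul_sub, mul_one, map_sub, sub_eq_zero] at this
    rw [IsIdempotentElem, ← map_mul, ← this]
  have hzero : aeval A (u * X ^ (m + 1)) = 0 := by
    refine eq_zero_of_isIdempotentElem_of_trace_eq_zero hidem ?_
    rw [pow_succ, ← mul_assoc]
    exact trace_aeval_mul_X_eq_zero h _
  refine ⟨m, ?_⟩
  calc A ^ m = aeval A (X ^ m * (u * X ^ (m + 1) + v * q)) := by rw [huv]; simp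
    _ = aeval A (X ^ m * (u * X ^ (m + 1)) + v * (X ^ m * q)) := by congr 1; ring
    _ = 0 := by rw [map_add, map_mul _ (X ^ m), map_mul _ v, hzero, hA, mul_zero, mul_zero, add_zero]

end LinearMap

/-! ### Curvature operators on a single tangent space -/

namespace CovTensor

theorem eq_zero_of_isNilpotent_smul_one {V : Type*} [AddCommGroup V] [Module ℝ V] [Nontrivial V] {c : ℝ}
    (h : IsNilpotent (c • (1 : Module.End ℝ (⨂[ℝ] _ : Fin 1, V)))) : c = 0 := by
  have : Nontrivial (⨂[ℝ] _ : Fin 1, V) :=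
    (PiTensorProduct.subsingletonEquiv (R := ℝ) (s := fun _ : Fin 1 => V) 0).toEquiv.nontrivial
  obtain ⟨n, hn⟩ := h
  rw [smul_pow, one_pow, smul_eq_zero_iff_left one_ne_zero] at hn
  exact eq_zero_of_pow_eq_zero hn

variable {V : Type*} [AddCommGroup V] [Module ℝ V] [FiniteDimensional ℝ V]
  (B : LinearMap.BilinForm ℝ V) (hB : B.Nondegenerate)

theorem contract_apply {r : ℕ} (T : MultilinearMap ℝ (fun _ : Fin (r + 2) => V) ℝ)
    (v : Fin r → V) :
    contract B hB T v = ∑ i, T (Fin.cons (Module.finBasis ℝ V i)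
      (Fin.cons (B.dualBasis hB (Module.finBasis ℝ V) i) v)) := by
  simp [contract]

/-- A decomposition into operators of rank at most one, from which the trace can be read off. -/
theorem toOperator_eq_sum {k : ℕ} (T : MultilinearMap ℝ (fun _ : Fin (k + k) => V) ℝ) :
    ∃ φ : (Fin k → Fin (Module.finrank ℝ V)) → ((⨂[ℝ] _ : Fin k, V) →ₗ[ℝ] ℝ),
      (∀ i v, φ i (PiTensorProduct.tprod ℝ v) =
        T (Fin.append v (fun j => Module.finBasis ℝ V (i j)))) ∧
      toOperator B hB T = ∑ i, (φ i).smulRight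
        (PiTensorProduct.tprod ℝ fun j => B.dualBasis hB (Module.finBasis ℝ V) (i j)) := by
  let f (i : Fin k → Fin (Module.finrank ℝ V)) : MultilinearMap ℝ (fun _ : Fin k => V) ℝ :=
    -- `currySum` fixes the first block, so the blocks are swapped in order to fix the last `k`
    -- slots.
    (T.domDomCongr (finSumFinEquiv.symm.trans (Equiv.sumComm _ _))).currySum
      fun j => Module.finBasis ℝ V (i j)
  have hf (i v) : f i v = T (Fin.append v (fun j => Module.finBasis ℝ V (i j))) := by
    change T _ = T _
    congr 1
    ext x
    obtain ⟨x, rfl⟩ := finSumFinEquiv.surjective x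
    rcases x with x | x <;> simp [-Fin.natAdd_eq_addNat]
  refine ⟨fun i => PiTensorProduct.lift (f i), fun i v => by simp [hf], ?_⟩
  ext v
  simp [toOperator_tprod, hf]

theorem trace_toOperator {k : ℕ} (T : MultilinearMap ℝ (fun _ : Fin (k + k) => V) ℝ) :
    LinearMap.trace ℝ _ (toOperator B hB T) = ∑ i : Fin k → Fin (Module.finrank ℝ V),
      T (Fin.append (fun j => B.dualBasis hB (Module.finBasis ℝ V) (i j))
        (fun j => Module.finBasis ℝ V (i j))) := by
  obtain ⟨φ, hφ, hT⟩ := toOperator_eq_sum B hB T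
  simp [hT, hφ, LinearMap.trace_smulRight]

/-- The output indices of `T` are contracted with the input indices of `S`. -/
theorem toOperator_mul_toOperator {k : ℕ}
    {S T U : MultilinearMap ℝ (fun _ : Fin (k + k) => V) ℝ}
    (hU : ∀ v w : Fin k → V, U (Fin.append v w) = ∑ i : Fin k → Fin (Module.finrank ℝ V),
      T (Fin.append v fun j => Module.finBasis ℝ V (i j)) *
        S (Fin.append (fun j => B.dualBasis hB (Module.finBasis ℝ V) (i j)) w)) :
    toOperator B hB S * toOperator B hB T = toOperator B hB U := by
  ext v
  simp only [LinearMap.compMultilinearMap_apply, Module.End.mul_apply, toOperator_tprod, map_sum,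
    map_smul, Finset.smul_sum, smul_smul, hU, Finset.sum_smul]
  exact Finset.sum_comm

theorem toOperator_eq_smul_one {c : ℝ} {T : MultilinearMap ℝ (fun _ : Fin (1 + 1) => V) ℝ}
    (hT : ∀ v, T v = c * B (v 0) (v 1)) : toOperator B hB T = c • 1 := by
  ext v
  simp only [LinearMap.compMultilinearMap_apply, toOperator_tprod, hT, LinearMap.smul_apply,
    Module.End.one_apply, mul_smul, ← Finset.smul_sum]
  congr 1
  apply (PiTensorProduct.subsingletonEquiv (R := ℝ) (s := fun _ : Fin 1 => V) 0).injective
  rw [map_sum, ← (Equiv.funUnique (Fin 1) (Fin (Module.finrank ℝ V))).symm.sum_comp]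
  simp only [map_smul, PiTensorProduct.subsingletonEquiv_apply_tprod]
  -- The coordinates of a vector in the dual basis are its products with the original basis.
  have := (B.dualBasis hB (Module.finBasis ℝ V)).sum_repr (v 0)
  simp only [LinearMap.BilinForm.dualBasis_repr_apply] at this
  exact this

end CovTensor

/-! ### Curvature tensors with labelled slots, and their contractions -/

namespace PseudoRiemannianMetric

variable {E : Type*} [NormedAddCommGroup E] [NormedSpace ℝ E] [FiniteDimensional ℝ E]
  {M : Type*} [TopologicalSpace M] [ChartedSpace E M] [IsManifold 𝓘(ℝ, E) ∞ M]
  (g : PseudoRiemannianMetric E M)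

/-- The chosen basis of the tangent space used for metric contractions. -/
noncomputable abbrev frame (p : M) (i : Fin (Module.finrank ℝ (TangentSpace 𝓘(ℝ, E) p))) :
    TangentSpace 𝓘(ℝ, E) p :=
  Module.finBasis ℝ (TangentSpace 𝓘(ℝ, E) p) i

/-- The dual basis of `frame` for the metric. -/
noncomputable abbrev coframe (p : M) (i : Fin (Module.finrank ℝ (TangentSpace 𝓘(ℝ, E) p))) :
    TangentSpace 𝓘(ℝ, E) p :=
  (g.bilin p).dualBasis (g.bilin_nondegenerate p) (Module.finBasis ℝ (TangentSpace 𝓘(ℝ, E) p)) i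

/-- A function of families of tangent vectors indexed by an arbitrary type that is, up to an
enumeration of the indices, a tensor field built from the curvature. -/
def IsCurvatureFunction (ι : Type) (F : ∀ p : M, (ι → TangentSpace 𝓘(ℝ, E) p) → ℝ) : Prop :=
  ∃ (r : ℕ) (e : Fin r ≃ ι) (T : CovTensorField E M r), g.IsCurvatureTensor r T ∧
    ∀ p v, F p v = T p (v ∘ e)

variable {g}

theorem IsCurvatureTensor.isCurvatureFunction {r : ℕ} {T : CovTensorField E M r}
    (hT : g.IsCurvatureTensor r T) : g.IsCurvatureFunction (Fin r) fun p => T p :=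
  ⟨r, Equiv.refl _, T, hT, fun _ _ => rfl⟩

namespace IsCurvatureFunction

theorem exists_isCurvatureTensor {r : ℕ}
    {F : ∀ p : M, (Fin r → TangentSpace 𝓘(ℝ, E) p) → ℝ} (hF : g.IsCurvatureFunction (Fin r) F) :
    ∃ T : CovTensorField E M r, g.IsCurvatureTensor r T ∧ ∀ p v, T p v = F p v := by
  obtain ⟨s, e, T, hT, h⟩ := hF
  exact ⟨_, hT.permute e, fun p v => (h p v).symm⟩

theorem reindex {ι κ : Type} {F : ∀ p : M, (ι → TangentSpace 𝓘(ℝ, E) p) → ℝ}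
    (hF : g.IsCurvatureFunction ι F) (e : ι ≃ κ) :
    g.IsCurvatureFunction κ fun p v => F p (v ∘ e) := by
  obtain ⟨s, e', T, hT, h⟩ := hF
  exact ⟨s, e'.trans e, T, hT, fun p v => h p _⟩

theorem mul {ι κ : Type} {F : ∀ p : M, (ι → TangentSpace 𝓘(ℝ, E) p) → ℝ}
    {G : ∀ p : M, (κ → TangentSpace 𝓘(ℝ, E) p) → ℝ}
    (hF : g.IsCurvatureFunction ι F) (hG : g.IsCurvatureFunction κ G) :
    g.IsCurvatureFunction (ι ⊕ κ) fun p v => F p (v ∘ Sum.inl) * G p (v ∘ Sum.inr) := by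
  obtain ⟨r, e, S, hS, h⟩ := hF
  obtain ⟨s, e', T, hT, h'⟩ := hG
  refine ⟨r + s, finSumFinEquiv.symm.trans (e.sumCongr e'), _, hS.mul hT, fun p v => ?_⟩
  beta_reduce
  rw [h, h', CovTensor.mul_apply]
  congr 2 <;> ext i <;> simp [-Fin.natAdd_eq_addNat]

/-- Contraction of a single pair of indices. -/
theorem contract_option {ι : Type} {F : ∀ p : M, (Option (Option ι) → TangentSpace 𝓘(ℝ, E) p) → ℝ}
    (hF : g.IsCurvatureFunction (Option (Option ι)) F) :
    g.IsCurvatureFunction ι fun p v => ∑ i, F p fun x =>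
      x.elim (frame p i) fun y => y.elim (g.coframe p i) v := by
  obtain ⟨s, e, S, hS, h⟩ := hF
  have : Finite (Option (Option ι)) := Finite.of_equiv _ e
  have : Finite ι := Finite.of_injective (fun x : ι => some (some x)) fun x y hxy => by simpa using hxy
  obtain ⟨r, ⟨e'⟩⟩ := Finite.exists_equiv_fin ι
  -- The two outer `none` labels go to slots 0 and 1, the ones that `CovTensor.contract` acts on.
  let e₂ : Fin (r + 2) ≃ Option (Option ι) := (finSuccEquiv (r + 1)).trans
    (Equiv.optionCongr ((finSuccEquiv r).trans (Equiv.optionCongr e'.symm)))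
  have h0 : e₂ 0 = none := rfl
  have h1 : e₂ 1 = some none := rfl
  have h2 (z : Fin r) : e₂ z.succ.succ = some (some (e'.symm z)) := rfl
  refine ⟨r, e'.symm, _, (hS.permute (e.trans e₂.symm)).contract, fun p v => ?_⟩
  rw [CovTensor.contract_apply]
  refine Finset.sum_congr rfl fun i _ => ?_
  rw [h, MultilinearMap.domDomCongr_apply]
  congr 1
  ext j
  simp only [Function.comp_apply, Equiv.trans_apply]
  obtain ⟨x, hx⟩ := e₂.surjective (e j)
  rw [← hx, Equiv.symm_apply_apply]
  clear hx
  refine Fin.cases ?_ (fun y => Fin.cases ?_ (fun z => ?_) y) x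
  · simp [h0]
  · simp [h1]
  · simp [h2]

/-- Simultaneous contraction of `k` pairs of indices. -/
theorem contract (k : ℕ) : ∀ {ι : Type}
    {F : ∀ p : M, (ι ⊕ (Fin k ⊕ Fin k) → TangentSpace 𝓘(ℝ, E) p) → ℝ},
    g.IsCurvatureFunction (ι ⊕ (Fin k ⊕ Fin k)) F →
    g.IsCurvatureFunction ι fun p v =>
      ∑ i : Fin k → Fin (Module.finrank ℝ (TangentSpace 𝓘(ℝ, E) p)),
        F p (Sum.elim v (Sum.elim (fun j => frame p (i j)) fun j => g.coframe p (i j))) := by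
  induction k with
  | zero =>
    intro ι F hF
    obtain ⟨s, e, T, hT, h⟩ := hF.reindex (Equiv.sumEmpty ι (Fin 0 ⊕ Fin 0))
    refine ⟨s, e, T, hT, fun p v => ?_⟩
    rw [← h]
    beta_reduce
    rw [Fintype.sum_unique]
    congr 1
    ext x
    rcases x with x | x
    · rfl
    · exact isEmptyElim x
  | succ k ih =>
    intro ι F hF
    -- Index 0 of each block becomes an outer `none`: this pair is contracted singly, the others by
    -- induction.
    let e : ι ⊕ (Fin (k + 1) ⊕ Fin (k + 1)) ≃ Option (Option (ι ⊕ (Fin k ⊕ Fin k))) :=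
      { toFun := Sum.elim (fun x => some (some (.inl x))) (Sum.elim
          (Fin.cases none fun j => some (some (.inr (.inl j))))
          (Fin.cases (some none) fun j => some (some (.inr (.inr j)))))
        invFun := fun x => x.elim (.inr (.inl 0)) fun y => y.elim (.inr (.inr 0))
          (Sum.elim .inl (Sum.elim (fun j => .inr (.inl j.succ)) fun j => .inr (.inr j.succ)))
        left_inv := by
          rintro (x | x | x)
          · rfl
          all_goals refine Fin.cases ?_ (fun j => ?_) x <;> rfl
        right_inv := by rintro (_ | _ | x | x | x) <;> rfl }
    obtain ⟨s, e', T, hT, h⟩ := ih (hF.reindex e).contract_option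
    refine ⟨s, e', T, hT, fun p v => ?_⟩
    rw [← h]
    beta_reduce
    rw [← (Fin.consEquiv fun _ : Fin (k + 1) =>
      Fin (Module.finrank ℝ (TangentSpace 𝓘(ℝ, E) p))).sum_comp, Fintype.sum_prod_type,
      Finset.sum_comm]
    refine Finset.sum_congr rfl fun i _ => Finset.sum_congr rfl fun a _ => ?_
    congr 1
    ext x
    rcases x with x | x | x
    · rfl
    all_goals refine Fin.cases ?_ (fun j => ?_) x <;> rfl

end IsCurvatureFunction

/-! ### Powers and traces of curvature operators -/

theorem IsCurvatureTensor.exists_composition {k : ℕ} {S T : CovTensorField E M (k + k)}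
    (hS : g.IsCurvatureTensor (k + k) S) (hT : g.IsCurvatureTensor (k + k) T) :
    ∃ U : CovTensorField E M (k + k), g.IsCurvatureTensor (k + k) U ∧
      ∀ p, CovTensor.toOperator (g.bilin p) (g.bilin_nondegenerate p) (S p) *
        CovTensor.toOperator (g.bilin p) (g.bilin_nondegenerate p) (T p) =
          CovTensor.toOperator (g.bilin p) (g.bilin_nondegenerate p) (U p) := by
  have hS' := hS.isCurvatureFunction.reindex finSumFinEquiv.symm
  have hT' := hT.isCurvatureFunction.reindex finSumFinEquiv.symm
  -- From (`T` in, `T` out), (`S` in, `S` out) to free (`T` in, `S` out) and contracted (`T` out,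
  -- `S` in).
  let e : (Fin k ⊕ Fin k) ⊕ (Fin k ⊕ Fin k) ≃ (Fin k ⊕ Fin k) ⊕ (Fin k ⊕ Fin k) :=
    { toFun := Sum.elim (Sum.elim (fun i => .inl (.inl i)) fun i => .inr (.inl i))
        (Sum.elim (fun i => .inr (.inr i)) fun i => .inl (.inr i))
      invFun := Sum.elim (Sum.elim (fun i => .inl (.inl i)) fun i => .inr (.inr i))
        (Sum.elim (fun i => .inl (.inr i)) fun i => .inr (.inl i))
      left_inv := by rintro ((x | x) | (x | x)) <;> rfl
      right_inv := by rintro ((x | x) | (x | x)) <;> rfl }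
  obtain ⟨U, hU, h⟩ := ((((hT'.mul hS').reindex e).contract k).reindex
    finSumFinEquiv).exists_isCurvatureTensor
  refine ⟨U, hU, fun p => CovTensor.toOperator_mul_toOperator _ _ fun v w => ?_⟩
  rw [h]
  refine Finset.sum_congr rfl fun i _ => ?_
  congr 2 <;> ext x <;> obtain ⟨x, rfl⟩ := finSumFinEquiv.surjective x <;>
    rcases x with x | x <;> simp [e, -Fin.natAdd_eq_addNat]

theorem IsCurvatureTensor.exists_pow {k : ℕ} {T : CovTensorField E M (k + k)}
    (hT : g.IsCurvatureTensor (k + k) T) (n : ℕ) :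
    ∃ U : CovTensorField E M (k + k), g.IsCurvatureTensor (k + k) U ∧
      ∀ p, CovTensor.toOperator (g.bilin p) (g.bilin_nondegenerate p) (T p) ^ (n + 1) =
        CovTensor.toOperator (g.bilin p) (g.bilin_nondegenerate p) (U p) := by
  induction n with
  | zero => exact ⟨T, hT, fun p => by rw [zero_add, pow_one]⟩
  | succ n ih =>
    obtain ⟨U, hU, h⟩ := ih
    obtain ⟨W, hW, h'⟩ := hU.exists_composition hT
    exact ⟨W, hW, fun p => by rw [pow_succ, h, h']⟩

theorem IsCurvatureTensor.isPolynomialInvariant_trace {k : ℕ} {T : CovTensorField E M (k + k)}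
    (hT : g.IsCurvatureTensor (k + k) T) :
    g.IsPolynomialInvariant fun p => LinearMap.trace ℝ _
      (CovTensor.toOperator (g.bilin p) (g.bilin_nondegenerate p) (T p)) := by
  -- No index stays free. The blocks are swapped because the trace formula has the dual basis in the
  -- first block, whereas `contract` puts it in the second.
  obtain ⟨U, hU, h⟩ := (((hT.isCurvatureFunction.reindex (finSumFinEquiv.symm.trans
    ((Equiv.sumComm _ _).trans (Equiv.emptySum (Fin 0) (Fin k ⊕ Fin k)).symm))).contract
      k)).exists_isCurvatureTensor
  refine ⟨U, hU, funext fun p => ?_⟩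
  rw [h, CovTensor.trace_toOperator]
  refine Finset.sum_congr rfl fun i _ => ?_
  congr 1
  ext x
  obtain ⟨x, rfl⟩ := finSumFinEquiv.surjective x
  rcases x with x | x <;> simp [-Fin.natAdd_eq_addNat]

/-- Every term has a factor `∇ⁱ Rm`, of positive rank and so zero in dimension zero. Nonzero
constants, which would break the equivalence there, are thereby excluded. -/
theorem IsCurvatureTensor.eq_zero_of_subsingleton [Subsingleton E] {r : ℕ}
    {T : CovTensorField E M r} (hT : g.IsCurvatureTensor r T) (p : M) : T p = 0 := by
  have : Subsingleton (TangentSpace 𝓘(ℝ, E) p) := inferInstanceAs (Subsingleton E)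
  induction hT with
  | curvature i =>
    ext v
    exact (g.curvature i p).map_coord_zero (⟨0, by omega⟩ : Fin (4 + i)) (Subsingleton.elim _ _)
  | add _ _ hS hT => simp [hS, hT]
  | smul c _ hT => simp [hT]
  | mul _ _ hS hT => ext v; simp [CovTensor.mul_apply, hS]
  | mulMetric _ hT => ext v; simp [CovTensor.mul_apply, hT]
  | permute e _ hT => ext v; simp [hT]
  | contract _ hT => ext v; simp [CovTensor.contract_apply, hT]

end PseudoRiemannianMetric

/-! ### The equivalence -/

theorem mainTheorem3 {E : Type*} [NormedAddCommGroup E] [NormedSpace ℝ E] [FiniteDimensional ℝ E]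
    {M : Type*} [TopologicalSpace M] [ChartedSpace E M] [IsManifold 𝓘(ℝ, E) ∞ M]
    (g : PseudoRiemannianMetric E M) :
    g.IsVSI ↔
      ∀ (p : M) (k : ℕ), 1 ≤ k →
        ∀ A : Module.End ℝ (⨂[ℝ] _ : Fin k, TangentSpace 𝓘(ℝ, E) p),
          g.IsCurvatureOperator p k A → IsNilpotent A := by
  constructor
  · rintro hg p k - A ⟨T, hT, rfl⟩
    refine LinearMap.isNilpotent_of_trace_pow_eq_zero fun n => ?_
    obtain ⟨U, hU, h⟩ := hT.exists_pow n
    rw [h]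
    exact hg _ hU.isPolynomialInvariant_trace p
  · rintro h f ⟨T, hT, rfl⟩ p
    rcases subsingleton_or_nontrivial E with hE | hE
    · simp [hT.eq_zero_of_subsingleton p]
    -- The test operator comes from the invariant times the metric, with `k = 1`; the permutation
    -- only recasts the rank.
    have hA := h p 1 le_rfl _ ⟨_, hT.mulMetric.permute (finCongr rfl : Fin (0 + 2) ≃ Fin (1 + 1)),
      rfl⟩
    have : Nontrivial (TangentSpace 𝓘(ℝ, E) p) := hE
    rw [CovTensor.toOperator_eq_smul_one _ _ (c := T p ![]) fun v => ?_] at hA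
    · exact CovTensor.eq_zero_of_isNilpotent_smul_one hA
    · rw [MultilinearMap.domDomCongr_apply, CovTensor.mul_apply, CovTensor.ofBilin_apply]
      exact congrArg₂ _ (congrArg (T p) (Subsingleton.elim _ _)) rfl
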